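/- Let $H$ be an infinite-dimensional real Hilbert space with closed unit ball $B_H=\{x\in H:\|x\|\le 1\}$. For a map $T\colon B_H\to B_H$ let $\mathrm{d}(T,B_H)=\inf_{x\in B_H}\|x-Tx\|$ denote its minimal displacement. (a) There exists a Lipschitz map $T\colon B_H\to B_H$ which has no fixed points and satisfies $\mathrm{d}(T,B_H)=0$. (b) For every $\alpha\in(0,1)$ and every $\lambda>0$ there exists a map $T\colon B_H\to B_H$ which has no fixed points, satisfies $\|Tx-Ty\|\le\lambda\|x-y\|^{\alpha}$ for all $x,y\in B_H$, and satisfies $\mathrm{d}(T,B_H)=0$. -/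

import Mathlib

open scoped NNReal

/-- The minimal displacement of a self-map `T` of a set `K`: the infimum of `‖x - T x‖` over `K`.
(The family is bounded below by `0`; only nonempty `K` is of interest.) -/
noncomputable def minimalDisplacement {X : Type*} [NormedAddCommGroup X] {K : Set X}
    (T : K → K) : ℝ :=
  ⨅ x : K, ‖(x : X) - (T x : X)‖

open scoped InnerProductSpace

/-! Let `V` shift an orthonormal sequence `e` and vanish on its orthogonal complement, and put `F x
= (1 - ‖x‖) • e 0 + V x`. A fixed point would have all its coefficients along `e` equal, hence zero
by square summability; this forces `x = 0`, yet `F 0 = e 0`. The unit vectors `(e 0 + ⋯ + e (N-1)) /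
√N` are moved by only `‖e 0 - e N‖ / √N`, so the displacement has infimum zero.

For the Hölder case, rescale: with `P` the radial retraction, `x ↦ r • F (P (r⁻¹ • x))` is
4-Lipschitz for every `r`, while its image lies in the ball of radius `r`. Interpolating between the
two bounds makes the Hölder constant as small as desired when `r → 0`. -/

lemma exists_orthonormal_sequence {H : Type*} [NormedAddCommGroup H] [InnerProductSpace ℝ H]
    [CompleteSpace H] (hH : ¬ FiniteDimensional ℝ H) : ∃ e : ℕ → H, Orthonormal ℝ e := by
  obtain ⟨w, b, -⟩ := exists_hilbertBasis ℝ H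
  have : Infinite w := by
    by_contra hw
    rw [not_infinite_iff_finite] at hw
    have := Fintype.ofFinite w
    exact hH b.toOrthonormalBasis.toBasis.finiteDimensional_of_finite
  exact ⟨fun n => b (Infinite.natEmbedding w n),
    b.orthonormal.comp _ (Infinite.natEmbedding w).injective⟩

/-- The isometric embedding of `ℓ²` whose image is the closed span of an orthonormal sequence. -/
lemma Orthonormal.exists_linearIsometry_lp {H : Type*} [NormedAddCommGroup H]
    [InnerProductSpace ℝ H] [CompleteSpace H] {e : ℕ → H} (he : Orthonormal ℝ e) :
    ∃ A : lp (fun _ : ℕ => ℝ) 2 →ₗᵢ[ℝ] H, ∀ n, A (lp.single 2 n (1 : ℝ)) = e n :=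
  ⟨he.orthogonalFamily.linearIsometry, fun n => by
    rw [OrthogonalFamily.linearIsometry_apply_single]; simp⟩

/-- The unilateral shift along an orthonormal sequence, extended by zero. -/
lemma Orthonormal.exists_shift {H : Type*} [NormedAddCommGroup H] [InnerProductSpace ℝ H]
    [CompleteSpace H] {e : ℕ → H} (he : Orthonormal ℝ e) :
    ∃ V : H →L[ℝ] H, (∀ x, ‖V x‖ ≤ ‖x‖) ∧ (∀ x, ⟪e 0, V x⟫_ℝ = 0) ∧
      (∀ n, V (e n) = e (n + 1)) ∧ ∀ (c : ℝ) x, c • e 0 + V x = x → x = 0 := by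
  obtain ⟨A, hA⟩ := he.exists_linearIsometry_lp
  obtain ⟨B, hB⟩ := (he.comp _ Nat.succ_injective).exists_linearIsometry_lp
  have hAcoord : ∀ x n, A.toContinuousLinearMap.adjoint x n = ⟪e n, x⟫_ℝ := fun x n => by
    have := ContinuousLinearMap.adjoint_inner_right A.toContinuousLinearMap
      (lp.single 2 n (1 : ℝ)) x
    rw [lp.inner_single_left] at this
    simpa [hA] using this
  have hBcoord : ∀ x n, B.toContinuousLinearMap.adjoint x n = ⟪e (n + 1), x⟫_ℝ := fun x n => by
    have := ContinuousLinearMap.adjoint_inner_right B.toContinuousLinearMap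
      (lp.single 2 n (1 : ℝ)) x
    rw [lp.inner_single_left] at this
    simpa [hB] using this
  have h0 : ∀ z, ⟪e 0, B z⟫_ℝ = 0 := fun z => by
    have h : B.toContinuousLinearMap.adjoint (e 0) = 0 := by
      ext n
      rw [hBcoord, he.2 (Nat.succ_ne_zero n)]
      rfl
    have := ContinuousLinearMap.adjoint_inner_left B.toContinuousLinearMap z (e 0)
    rw [h, inner_zero_left] at this
    exact this.symm
  have hsucc : ∀ n z, ⟪e (n + 1), B z⟫_ℝ = z n := fun n z => by
    have : e (n + 1) = B (lp.single 2 n (1 : ℝ)) := (hB n).symm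
    rw [this, B.inner_map_map, lp.inner_single_left]
    simp
  -- The adjoint of `A` reads off the coefficients along `e`; `B` puts them back one index later.
  refine ⟨B.toContinuousLinearMap ∘L A.toContinuousLinearMap.adjoint, fun x => ?_,
    fun x => h0 _, fun n => ?_, fun c x hx => ?_⟩
  · change ‖B _‖ ≤ _
    rw [B.norm_map]
    refine (ContinuousLinearMap.le_opNorm _ _).trans ?_
    rw [LinearIsometryEquiv.norm_map]
    exact mul_le_of_le_one_left (norm_nonneg _) A.norm_toContinuousLinearMap_le
  · have : A.toContinuousLinearMap.adjoint (e n) = lp.single 2 n (1 : ℝ) := by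
      ext m
      rw [hAcoord, orthonormal_iff_ite.1 he, lp.single_apply]
      by_cases h : m = n
      · subst h; simp
      · simp [h]
    change B (A.toContinuousLinearMap.adjoint (e n)) = _
    rw [this, hB]
    rfl
  · replace hx : c • e 0 + B (A.toContinuousLinearMap.adjoint x) = x := hx
    -- Pairing the fixed-point equation with `e 0` gives `c`; pairing it with `e (n + 1)` gives the
    -- previous coefficient.
    have hz : ∀ n, ⟪e n, x⟫_ℝ = c := by
      intro n
      induction n with
      | zero =>
        rw [← hx, inner_add_right, h0, inner_smul_right, real_inner_self_eq_norm_sq, he.1]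
        simp
      | succ n ih =>
        rw [← hx, inner_add_right, hsucc, hAcoord, ih, inner_smul_right,
          he.2 (Nat.succ_ne_zero n)]
        simp
    -- By Bessel's inequality the constant sequence `c ^ 2` is summable.
    have hc : c = 0 := by
      have h := he.inner_products_summable (x := x)
      simp only [hz, summable_const_iff] at h
      simpa using h
    have : A.toContinuousLinearMap.adjoint x = 0 := by
      ext n
      rw [hAcoord, hz, hc]
      rfl
    rw [← hx, this, hc, map_zero, zero_smul, add_zero]

/-- A self-map of a nonempty set has zero minimal displacement once it has points of
arbitrarily small displacement. -/
lemma minimalDisplacement_eq_zero {X : Type*} [NormedAddCommGroup X] {K : Set X} (T : K → K)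
    (h : ∀ ε > 0, ∃ x : K, ‖(x : X) - (T x : X)‖ ≤ ε) : minimalDisplacement T = 0 := by
  have : Nonempty K := (h 1 one_pos).nonempty
  refine le_antisymm (le_of_forall_pos_le_add fun ε hε => ?_)
    (Real.iInf_nonneg fun _ => norm_nonneg _)
  obtain ⟨x, hx⟩ := h ε hε
  rw [zero_add]
  exact (ciInf_le ⟨0, by rintro _ ⟨y, rfl⟩; exact norm_nonneg _⟩ x).trans hx

lemma Orthonormal.norm_sum_range {H : Type*} [NormedAddCommGroup H] [InnerProductSpace ℝ H]
    {e : ℕ → H} (he : Orthonormal ℝ e) (N : ℕ) : ‖∑ i ∈ Finset.range N, e i‖ = √N := by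
  have h := he.inner_sum (fun _ => 1) (fun _ => 1) (Finset.range N)
  simp only [one_smul, map_one, mul_one, Finset.sum_const, Finset.card_range, nsmul_eq_mul,
    real_inner_self_eq_norm_sq] at h
  rw [← h, Real.sqrt_sq (norm_nonneg _)]

/-- A `2`-Lipschitz map from an infinite-dimensional Hilbert space to its unit ball with no fixed
points, but with points of the unit ball displaced arbitrarily little. -/
lemma exists_lipschitz_fixedPointFree {H : Type*} [NormedAddCommGroup H]
    [InnerProductSpace ℝ H] [CompleteSpace H] (hH : ¬ FiniteDimensional ℝ H) :
    ∃ F : H → H, (∀ x y, ‖F x - F y‖ ≤ 2 * ‖x - y‖) ∧ (∀ x, ‖x‖ ≤ 1 → ‖F x‖ ≤ 1) ∧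
      (∀ x, F x ≠ x) ∧ ∀ ε > 0, ∃ x, ‖x‖ ≤ 1 ∧ ‖x - F x‖ ≤ ε := by
  obtain ⟨e, he⟩ := exists_orthonormal_sequence hH
  obtain ⟨V, hV, h0, hVe, hfix⟩ := he.exists_shift
  have he1 := he.1
  refine ⟨fun x => (1 - ‖x‖) • e 0 + V x, fun x y => ?_, fun x hx => ?_, fun x hx => ?_,
    fun ε hε => ?_⟩
  · have : (1 - ‖x‖) • e 0 + V x - ((1 - ‖y‖) • e 0 + V y)
        = (‖y‖ - ‖x‖) • e 0 + V (x - y) := by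
      rw [map_sub]; module
    rw [this]
    refine (norm_add_le _ _).trans ?_
    rw [norm_smul, he1, mul_one, Real.norm_eq_abs, abs_sub_comm]
    linarith [abs_norm_sub_norm_le x y, hV (x - y)]
  -- Pythagoras, as `V x ⟂ e 0`; then `(1 - t) ^ 2 + t ^ 2 ≤ 1` on `[0, 1]`.
  · have hsq : ‖(1 - ‖x‖) • e 0 + V x‖ ^ 2 = (1 - ‖x‖) ^ 2 + ‖V x‖ ^ 2 := by
      rw [norm_add_sq_real, inner_smul_left, h0, norm_smul, he1, mul_one, Real.norm_eq_abs,
        sq_abs]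
      simp
    have : ‖V x‖ ^ 2 ≤ ‖x‖ ^ 2 := by gcongr; exact hV x
    change ‖(1 - ‖x‖) • e 0 + V x‖ ≤ 1
    nlinarith [norm_nonneg x, norm_nonneg ((1 - ‖x‖) • e 0 + V x)]
  · replace hx : (1 - ‖x‖) • e 0 + V x = x := hx
    have hx0 : x = 0 := hfix _ _ hx
    have he0 : e 0 = 0 := by simpa [hx0] using hx
    exact he.ne_zero 0 he0
  · obtain ⟨N, hN⟩ := exists_nat_gt ((2 / ε) ^ 2)
    have hN' : 2 / ε < √N := Real.lt_sqrt_of_sq_lt hN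
    have hpos : 0 < √N := lt_trans (by positivity) hN'
    set s := ∑ i ∈ Finset.range N, e i with hs
    have hns : ‖s‖ = √N := he.norm_sum_range N
    -- Shifting the sum only trades its first term for a new last one.
    have hVs : V s = s + (e N - e 0) := by
      rw [hs, map_sum, ← Finset.sum_range_sub e N, ← Finset.sum_add_distrib]
      exact Finset.sum_congr rfl fun i _ => by rw [hVe]; abel
    have hn1 : ‖(√N)⁻¹ • s‖ = 1 := by
      rw [norm_smul, hns, norm_inv, Real.norm_of_nonneg hpos.le, inv_mul_cancel₀ hpos.ne']
    refine ⟨(√N)⁻¹ • s, hn1.le, ?_⟩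
    have : (√N)⁻¹ • s - ((1 - ‖(√N)⁻¹ • s‖) • e 0 + V ((√N)⁻¹ • s))
        = (√N)⁻¹ • (e 0 - e N) := by
      rw [hn1, map_smul, hVs]; module
    rw [this, norm_smul, norm_inv, Real.norm_of_nonneg hpos.le]
    have h2 : ‖e 0 - e N‖ ≤ 2 := (norm_sub_le _ _).trans (by rw [he1, he1]; norm_num)
    rw [inv_mul_le_iff₀ hpos]
    rw [div_lt_iff₀ hε] at hN'
    exact h2.trans hN'.le

/-- The radial retraction onto the closed unit ball is Lipschitz with constant `2`. -/
lemma exists_retraction_unitBall (H : Type*) [NormedAddCommGroup H] [NormedSpace ℝ H] :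
    ∃ P : H → H, (∀ x y, ‖P x - P y‖ ≤ 2 * ‖x - y‖) ∧ (∀ x, ‖P x‖ ≤ 1) ∧
      ∀ x, ‖x‖ ≤ 1 → P x = x := by
  refine ⟨fun x => (max 1 ‖x‖)⁻¹ • x, fun x y => ?_, fun x => ?_, fun x hx => ?_⟩
  · have hx : 0 < max 1 ‖x‖ := by positivity
    have hy : 0 < max 1 ‖y‖ := by positivity
    set a := max 1 ‖x‖ with ha
    set b := max 1 ‖y‖ with hb
    have ha1 : 1 ≤ a := le_max_left _ _
    have hyb : ‖y‖ ≤ b := le_max_right _ _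
    have hab : |b - a| ≤ ‖x - y‖ := by
      rw [ha, hb, max_comm 1, max_comm 1]
      refine (abs_max_sub_max_le_abs _ _ _).trans ?_
      rw [abs_sub_comm]
      exact abs_norm_sub_norm_le x y
    have key : a⁻¹ • x - b⁻¹ • y = a⁻¹ • ((x - y) + ((b - a) * b⁻¹) • y) := by
      have : (b - a) * b⁻¹ = 1 - a * b⁻¹ := by field_simp
      rw [this, smul_add, smul_smul, mul_sub, inv_mul_cancel_left₀ hx.ne']
      module
    change ‖a⁻¹ • x - b⁻¹ • y‖ ≤ _
    have hby : b⁻¹ * ‖y‖ ≤ 1 := by rw [inv_mul_le_iff₀ hy]; simpa using hyb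
    have h2 : ‖((b - a) * b⁻¹) • y‖ ≤ ‖x - y‖ := by
      rw [norm_smul, norm_mul, norm_inv, Real.norm_of_nonneg hy.le, mul_assoc, Real.norm_eq_abs]
      exact (mul_le_of_le_one_right (abs_nonneg _) hby).trans hab
    rw [key, norm_smul, norm_inv, Real.norm_of_nonneg hx.le, inv_mul_le_iff₀ hx]
    refine (norm_add_le _ _).trans ?_
    nlinarith [norm_nonneg (x - y)]
  · have hx : 0 < max 1 ‖x‖ := by positivity
    rw [norm_smul, norm_inv, Real.norm_of_nonneg hx.le, inv_mul_le_iff₀ hx, mul_one]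
    exact le_max_right _ _
  · simp [max_eq_left hx]

/-- A map that is both Lipschitz and of small diameter is Hölder with small constant. -/
lemma le_mul_rpow_of_le_of_le {t d C r α lam : ℝ} (ht : 0 ≤ t) (hd : 0 ≤ d) (hC : 0 ≤ C)
    (hα₀ : 0 < α) (hα : α < 1) (h₁ : t ≤ C * d) (h₂ : t ≤ r)
    (hlam : C ^ α * r ^ (1 - α) ≤ lam) : t ≤ lam * d ^ α := by
  calc t = t ^ α * t ^ (1 - α) := by
        rw [← Real.rpow_add' ht (by norm_num), add_sub_cancel, Real.rpow_one]
    _ ≤ (C * d) ^ α * r ^ (1 - α) := by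
        gcongr
    _ = (C ^ α * r ^ (1 - α)) * d ^ α := by rw [Real.mul_rpow hC hd]; ring
    _ ≤ lam * d ^ α := by gcongr

theorem proposition4p8 {H : Type*} [NormedAddCommGroup H] [InnerProductSpace ℝ H]
    [CompleteSpace H] (hH : ¬ FiniteDimensional ℝ H) :
    (∃ T : Metric.closedBall (0 : H) 1 → Metric.closedBall (0 : H) 1,
      (∃ L : ℝ≥0, LipschitzWith L T) ∧
      Function.fixedPoints T = ∅ ∧
      minimalDisplacement T = 0) ∧
    (∀ α lam : ℝ≥0, 0 < α → α < 1 → 0 < lam →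
      ∃ T : Metric.closedBall (0 : H) 1 → Metric.closedBall (0 : H) 1,
        HolderWith lam α T ∧
        Function.fixedPoints T = ∅ ∧
        minimalDisplacement T = 0) := by
  obtain ⟨F, hLip, hball, hfix, happrox⟩ := exists_lipschitz_fixedPointFree hH
  refine ⟨⟨fun x => ⟨F x, ?_⟩, ⟨2, ?_⟩, ?_, ?_⟩, fun α lam hα₀ hα hlam => ?_⟩
  · rw [mem_closedBall_zero_iff]
    exact hball _ (mem_closedBall_zero_iff.1 x.2)
  · refine LipschitzWith.of_dist_le_mul fun x y => ?_
    rw [Subtype.dist_eq, Subtype.dist_eq, dist_eq_norm, dist_eq_norm]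
    exact hLip x y
  · exact Set.eq_empty_of_forall_notMem fun x hx => hfix x (congrArg Subtype.val hx)
  · refine minimalDisplacement_eq_zero _ fun ε hε => ?_
    obtain ⟨x, hx, hxε⟩ := happrox ε hε
    exact ⟨⟨x, mem_closedBall_zero_iff.2 hx⟩, hxε⟩
  · obtain ⟨P, hPLip, hPball, hPid⟩ := exists_retraction_unitBall H
    have hα₀' : (0 : ℝ) < α := hα₀
    have hα' : (α : ℝ) < 1 := hα
    have hlam' : (0 : ℝ) < lam := hlam
    -- Here `4 = 2 * 2` comes from the Lipschitz constants of `F` and `P`, and `2 * r` bounds the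
    -- diameter of the image.
    obtain ⟨r, hr, hr1, hrlam⟩ : ∃ r : ℝ, 0 < r ∧ r ≤ 1 ∧
        (4 : ℝ) ^ (α : ℝ) * (2 * r) ^ (1 - α : ℝ) ≤ lam := by
      have hcont : Filter.Tendsto (fun r : ℝ => (4 : ℝ) ^ (α : ℝ) * (2 * r) ^ (1 - α : ℝ))
          (nhdsWithin 0 (Set.Ioi 0)) (nhds 0) := by
        have : Continuous fun r : ℝ => (4 : ℝ) ^ (α : ℝ) * (2 * r) ^ (1 - α : ℝ) :=
          continuous_const.mul
            ((continuous_const.mul continuous_id).rpow_const fun _ => .inr (by linarith))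
        have h := this.tendsto 0
        rw [mul_zero, Real.zero_rpow (by linarith), mul_zero] at h
        exact h.mono_left nhdsWithin_le_nhds
      obtain ⟨r, hr₁, hr₂⟩ := ((hcont.eventually_le_const hlam').and
        (Ioc_mem_nhdsGT (zero_lt_one' ℝ))).exists
      exact ⟨r, hr₂.1, hr₂.2, hr₁⟩
    have hGball : ∀ x, ‖r • F (P (r⁻¹ • x))‖ ≤ r := fun x => by
      rw [norm_smul, Real.norm_of_nonneg hr.le]
      exact mul_le_of_le_one_right hr.le (hball _ (hPball _))
    have hGLip : ∀ x y, ‖r • F (P (r⁻¹ • x)) - r • F (P (r⁻¹ • y))‖ ≤ 4 * ‖x - y‖ :=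
      fun x y => by
        rw [← smul_sub, norm_smul, Real.norm_of_nonneg hr.le]
        have h₁ := hLip (P (r⁻¹ • x)) (P (r⁻¹ • y))
        have h₂ := hPLip (r⁻¹ • x) (r⁻¹ • y)
        rw [← smul_sub, norm_smul, norm_inv, Real.norm_of_nonneg hr.le] at h₂
        calc r * ‖F (P (r⁻¹ • x)) - F (P (r⁻¹ • y))‖
            ≤ r * (2 * (2 * (r⁻¹ * ‖x - y‖))) := by gcongr; linarith
          _ = 4 * ‖x - y‖ := by field_simp; ring
    refine ⟨fun x => ⟨r • F (P (r⁻¹ • (x : H))), ?_⟩, fun x y => ?_, ?_, ?_⟩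
    · rw [mem_closedBall_zero_iff]
      exact (hGball _).trans hr1
    · rw [edist_dist, edist_dist, ENNReal.ofReal_rpow_of_nonneg dist_nonneg hα₀'.le,
        ← ENNReal.ofReal_coe_nnreal, ← ENNReal.ofReal_mul lam.coe_nonneg]
      refine ENNReal.ofReal_le_ofReal ?_
      rw [Subtype.dist_eq, Subtype.dist_eq, dist_eq_norm, dist_eq_norm]
      refine le_mul_rpow_of_le_of_le (norm_nonneg _) (norm_nonneg _) (by norm_num)
        hα₀' hα' (hGLip _ _) ?_ hrlam
      refine (norm_sub_le _ _).trans ?_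
      linarith [hGball x, hGball y]
    · refine Set.eq_empty_of_forall_notMem fun x hx => ?_
      have hx : r • F (P (r⁻¹ • (x : H))) = x := congrArg Subtype.val hx
      -- A fixed point lies in the image, hence in the ball of radius `r`, where the retraction does
      -- nothing; so `r⁻¹ • x` would be fixed by `F`.
      have hP : P (r⁻¹ • (x : H)) = r⁻¹ • (x : H) := by
        refine hPid _ ?_
        rw [norm_smul, norm_inv, Real.norm_of_nonneg hr.le, inv_mul_le_iff₀ hr, mul_one, ← hx]
        exact hGball _
      rw [hP] at hx
      refine hfix (r⁻¹ • (x : H)) ?_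
      conv_rhs => rw [← hx]
      rw [inv_smul_smul₀ hr.ne']
    · refine minimalDisplacement_eq_zero _ fun ε hε => ?_
      obtain ⟨x, hx, hxε⟩ := happrox ε hε
      refine ⟨⟨r • x, mem_closedBall_zero_iff.2 ?_⟩, ?_⟩
      · rw [norm_smul, Real.norm_of_nonneg hr.le]
        exact mul_le_one₀ hr1 (norm_nonneg _) hx
      · change ‖r • x - r • F (P (r⁻¹ • r • x))‖ ≤ ε
        rw [inv_smul_smul₀ hr.ne', hPid x hx, ← smul_sub, norm_smul, Real.norm_of_nonneg hr.le]
        exact (mul_le_of_le_one_left (norm_nonneg _) hr1).trans hxε
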